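/- Let $n\ge 1$ and let $\mathbb T^n=(S^1)^n$. A $2n$-dimensional quasitoric manifold is a closed connected smooth $2n$-manifold $M$ with a smooth action of $\mathbb T^n$ such that (1) the action is locally standard: every $y\in M$ has a $\mathbb T^n$-invariant open neighbourhood $U$ with a diffeomorphism $\psi$ onto a $\mathbb T^n$-invariant open subset of $\mathbb C^n$ and an automorphism $\delta$ of $\mathbb T^n$ such that $\psi(t\cdot x)=\delta(t)\cdot\psi(x)$ for all $t\in\mathbb T^n$, $x\in U$, where $\mathbb T^n$ acts on $\mathbb C^n$ by coordinatewise multiplication; (2) there are an $n$-dimensional simple convex polytope $P\subset\mathbb R^n$ (exactly $n$ facets meet at each vertex) and a continuous surjection $\mathfrak q:M\to P$ whose fibres are exactly the $\mathbb T^n$-orbits and which maps every $l$-dimensional orbit to a point in the relative interior of an $l$-dimensional face of $P$. For a $G$-space $X$, a $G$-invariant open subset $U\subseteq X$ is called $G$-categorical if there is a continuous map $H:U\times[0,1]\to X$ with $gH(x,t)=H(gx,t)$ for all $g\in G$, $x\in U$, $t\in[0,1]$, with $H(x,0)=x$ for all $x\in U$, and with $H(U\times\{1\})$ contained in a single $G$-orbit.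 The equivariant LS-category $cat_G(X)$ is the least number of $G$-categorical subsets that cover $X$ ($\infty$ if there is no finite such covering). **Theorem.** Let $M$ be a $2n$-dimensional quasitoric manifold. Then the fixed point set $M^{\mathbb T^n}$ is finite and, if $k$ is the number of its points, then $$cat_{\mathbb T^n}(M)=k .$$ -/

import Mathlib

open scoped Manifold ContDiff

/-! ### Equivariant Lusternik-Schnirelmann category -/

/-- A `G`-categorical subset `U` of a `G`-space `X`: a `G`-invariant open subset for which some
`G`-homotopy `H : U × I → X` starts at the inclusion and ends inside a single orbit. -/
def IsGCategorical (G : Type*) {X : Type*} [Group G] [TopologicalSpace X] [MulAction G X]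
    (U : Set X) : Prop :=
  IsOpen U ∧
  ∃ hU : ∀ (g : G), ∀ x ∈ U, g • x ∈ U,
  ∃ H : C(U × unitInterval, X),
    (∀ (g : G) (x : U) (t : unitInterval), g • H (x, t) = H (⟨g • (x : X), hU g x x.2⟩, t)) ∧
    (∀ x : U, H (x, 0) = x) ∧
    ∃ z : X, ∀ x : U, H (x, 1) ∈ MulAction.orbit G z

/-- `X` is covered by `m` `G`-categorical subsets. -/
def HasGCategoricalCover (G X : Type*) [Group G] [TopologicalSpace X] [MulAction G X]
    (m : ℕ) : Prop :=
  ∃ U : Fin m → Set X, (∀ i, IsGCategorical G (U i)) ∧ ⋃ i, U i = Set.univ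

/-- The equivariant LS-category `cat_G(X)`: the least number of members of a `G`-categorical
covering of `X`, and `∞` if there is no such (finite) covering. -/
noncomputable def equivariantLSCat (G X : Type*) [Group G] [TopologicalSpace X] [MulAction G X] :
    ℕ∞ :=
  ⨅ (m : ℕ) (_ : HasGCategoricalCover G X m), (m : ℕ∞)

/-! ### Simple polytopes -/

/-- `F` is a (nonempty) face of dimension `d` of the convex polytope `P`: a nonempty intersection
of `P` with a supporting hyperplane, or `P` itself. -/
def IsFaceOfDim {n : ℕ} (P F : Set (EuclideanSpace ℝ (Fin n))) (d : ℕ) : Prop :=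
  F.Nonempty ∧ IsExposed ℝ P F ∧ Module.finrank ℝ (vectorSpan ℝ F) = d

/-- An `n`-dimensional simple polytope in `ℝⁿ`: the convex hull of finitely many points, with
nonempty interior, such that exactly `n` facets (faces of dimension `n - 1`) contain any given
vertex. -/
structure IsSimplePolytope {n : ℕ} (P : Set (EuclideanSpace ℝ (Fin n))) : Prop where
  exists_finite : ∃ S : Set (EuclideanSpace ℝ (Fin n)), S.Finite ∧ P = convexHull ℝ S
  interior_nonempty : (interior P).Nonempty
  simple : ∀ v ∈ Set.extremePoints ℝ P,
    {F | ∃ d, d + 1 = n ∧ IsFaceOfDim P F d ∧ v ∈ F}.encard = n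

/-! ### Torus actions -/

/-- The compact torus `𝕋ⁿ = (S¹)ⁿ`. -/
abbrev CompactTorus (n : ℕ) : Type := Fin n → Circle

/-- The exponential map `ℝⁿ → 𝕋ⁿ` from the Lie algebra of the torus. -/
noncomputable def CompactTorus.exp {n : ℕ} (v : Fin n → ℝ) : CompactTorus n :=
  fun i => Circle.exp (v i)

theorem CompactTorus.exp_zero {n : ℕ} : CompactTorus.exp (0 : Fin n → ℝ) = 1 := by
  funext i
  simp [CompactTorus.exp]

theorem CompactTorus.exp_add {n : ℕ} (v w : Fin n → ℝ) :
    CompactTorus.exp (v + w) = CompactTorus.exp v * CompactTorus.exp w := by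
  funext i
  simp [CompactTorus.exp, Circle.exp_add]

/-- The Lie algebra of the stabilizer of `x`: all `v ∈ ℝⁿ` whose one-parameter subgroup
`s ↦ exp (s v)` fixes `x`. -/
noncomputable def stabilizerLieAlgebra {n : ℕ} {M : Type*} [MulAction (CompactTorus n) M]
    (x : M) : Submodule ℝ (Fin n → ℝ) where
  carrier := {v | ∀ s : ℝ, CompactTorus.exp (s • v) • x = x}
  zero_mem' := by
    intro s
    rw [smul_zero, CompactTorus.exp_zero, one_smul]
  add_mem' := by
    intro v w hv hw s
    rw [smul_add, CompactTorus.exp_add, mul_smul, hw s, hv s]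
  smul_mem' := by
    intro c v hv s
    rw [smul_smul]
    exact hv (s * c)

/-- The dimension of the orbit of `x`, which is diffeomorphic to `𝕋ⁿ / 𝕋ⁿₓ` and so has tangent
space `ℝⁿ / Lie(𝕋ⁿₓ)` at `x`. -/
noncomputable def orbitDim {n : ℕ} {M : Type*} [MulAction (CompactTorus n) M] (x : M) : ℕ :=
  Module.finrank ℝ ((Fin n → ℝ) ⧸ stabilizerLieAlgebra x)

section Quasitoric

variable (n : ℕ) (M : Type*) [TopologicalSpace M]
  [ChartedSpace (EuclideanSpace ℝ (Fin (2 * n))) M] [MulAction (CompactTorus n) M]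

/-- The action map `𝕋ⁿ × M → M` is smooth. -/
def IsSmoothTorusAction : Prop :=
  ContMDiff ((ModelWithCorners.pi fun _ : Fin n => 𝓡 1).prod (𝓡 (2 * n))) (𝓡 (2 * n)) ∞
    (fun p : CompactTorus n × M => p.1 • p.2)

/-- The action is locally standard: around every point there are an invariant open set `ψ.source`
and a diffeomorphism `ψ` onto an open subset `ψ.target` of `ℂⁿ` that, up to an automorphism `δ` of
the torus, intertwines the action with the coordinatewise multiplication of `𝕋ⁿ` on `ℂⁿ` (so that
`ψ.target` is invariant as well). -/
def IsLocallyStandard : Prop :=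
  ∀ y : M, ∃ (ψ : OpenPartialHomeomorph M (Fin n → ℂ)) (δ : CompactTorus n ≃ₜ* CompactTorus n),
    y ∈ ψ.source ∧
    ContMDiffOn (𝓡 (2 * n)) 𝓘(ℝ, Fin n → ℂ) ∞ ψ ψ.source ∧
    ContMDiffOn 𝓘(ℝ, Fin n → ℂ) (𝓡 (2 * n)) ∞ ψ.symm ψ.target ∧
    ∀ (t : CompactTorus n), ∀ x ∈ ψ.source,
      t • x ∈ ψ.source ∧ ψ (t • x) = fun i => (δ t i : ℂ) * ψ x i

/-- `M` with its `𝕋ⁿ`-action is a quasitoric manifold over the simple polytope `P`, with orbit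
projection `q : M → P`. (Orientability is automatic and is not asked for.) -/
structure IsQuasitoricOver (P : Set (EuclideanSpace ℝ (Fin n)))
    (q : M → EuclideanSpace ℝ (Fin n)) : Prop where
  isManifold : IsManifold (𝓡 (2 * n)) ∞ M
  compact : CompactSpace M
  hausdorff : T2Space M
  connected : ConnectedSpace M
  smooth_action : IsSmoothTorusAction n M
  locally_standard : IsLocallyStandard n M
  simple_polytope : IsSimplePolytope P
  boundary_nonempty : (frontier P).Nonempty
  continuous_proj : Continuous q
  range_proj : Set.range q = P
  /-- The fibres of `q` are the orbits, so `q` identifies the orbit space with `P`. -/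
  fibre_proj : ∀ x y : M, q x = q y ↔ x ∈ MulAction.orbit (CompactTorus n) y
  /-- Every `l`-dimensional orbit goes to a point in the (relative) interior of an
  `l`-dimensional face. -/
  orbit_dim : ∀ x : M, ∃ F, IsFaceOfDim P F (orbitDim (n := n) x) ∧ q x ∈ intrinsicInterior ℝ F

/-- `M` with its `𝕋ⁿ`-action is a `2n`-dimensional quasitoric manifold. -/
def IsQuasitoricManifold : Prop :=
  ∃ (P : Set (EuclideanSpace ℝ (Fin n))) (q : M → EuclideanSpace ℝ (Fin n)),
    IsQuasitoricOver n M P q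

end Quasitoric

open Set Filter Topology AffineMap

/-! Fixed points are exactly the points over vertices of `P`, one over each, so they are finite in
number. For the lower bound, an equivariant homotopy keeps a fixed point inside the finite, hence
discrete, fixed set, so the point does not move. A categorical set therefore contains at most one
fixed point (`IsGCategorical.eq_of_mem_fixedPoints`).

For the upper bound, the open stars of the vertices cover `P`, and each is star-shaped about its
vertex `v`. Contracting towards `v` is lifted to `M` by sending `g • σ p` to `g • σ p'`, where `σ`
is a local section of `q`. This is well defined as soon as the stabilizer of `σ p` fixes `σ p'`. It
does: short of `v` the face, and so the orbit dimension, does not change, which freezes the set of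
nonzero chart coordinates of `σ`; over `v` everything is fixed (`smul_section_lineMap`).

Sections exist only locally, so small cut-off motions are lifted
(`exists_equivariant_lift_of_section`) and composed along the segment to `v`
(`exists_isRadiallyContractible_nhds`). All motions are global and radial, so they also compose over
finitely many neighbourhoods, and compactness of `P` leaves one open set per vertex. -/

/-- A continuous homomorphism `ℝ → S¹` is `s ↦ exp (c s)` for some `c`. -/
theorem Circle.exists_eq_exp_mul {φ : ℝ → Circle} (hφ : Continuous φ)
    (hadd : ∀ s t, φ (s + t) = φ s * φ t) : ∃ c : ℝ, ∀ s, φ s = Circle.exp (c * s) := by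
  have h0 : φ 0 = 1 := by simpa using hadd 0 0
  obtain ⟨F, ⟨hF0, hF⟩, -⟩ := Circle.isCoveringMap_exp.existsUnique_continuousMap_lifts
    (⟨φ, hφ⟩ : C(ℝ, Circle)) 0 0 (by simp [h0])
  have hF' : ∀ s, Circle.exp (F s) = φ s := fun s => congrFun hF s
  have hFadd : ∀ s t, F (s + t) = F s + F t := by
    intro s
    refine congrFun (Circle.isCoveringMap_exp.eq_of_comp_eq (g₁ := fun t => F (s + t))
      (g₂ := fun t => F s + F t) (by fun_prop) (by fun_prop) ?_ 0 (by simp [hF0]))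
    funext t
    simp [hF', hadd, Circle.exp_add]
  let A : ℝ →+ ℝ := ⟨⟨F, hF0⟩, hFadd⟩
  refine ⟨F 1, fun s => ?_⟩
  have h := map_real_smul A F.continuous s 1
  have h' : F s = s * F 1 := by simpa [A] using h
  rw [← hF', h', mul_comm]

/-! ### Faces of polytopes and open stars of vertices -/

section Faces

variable {E : Type*} [NormedAddCommGroup E] [NormedSpace ℝ E]

/-- Since `p` is interior relative to the affine span, the line from `y` to `p` can be prolonged
slightly beyond `p` inside `F`. -/
theorem exists_mem_openSegment_of_mem_intrinsicInterior {F : Set E} {p y : E}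
    (hp : p ∈ intrinsicInterior ℝ F) (hy : y ∈ F) : ∃ z ∈ F, p ∈ openSegment ℝ y z := by
  obtain ⟨p', hp', rfl⟩ := hp
  let g : ℝ → affineSpan ℝ F := fun t =>
    ⟨lineMap y (p' : E) t, lineMap_mem t (subset_affineSpan ℝ F hy) p'.2⟩
  have hg1 : g 1 = p' := Subtype.ext (lineMap_apply_one _ _)
  have hc : Continuous g := Continuous.subtype_mk lineMap_continuous _
  have h1 : ∀ᶠ t in 𝓝 (1 : ℝ), g t ∈ interior ((↑) ⁻¹' F : Set (affineSpan ℝ F)) :=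
    hc.continuousAt.eventually_mem (by rw [hg1]; exact isOpen_interior.mem_nhds hp')
  obtain ⟨t, ht, ht1⟩ := ((h1.filter_mono nhdsWithin_le_nhds).and
    (self_mem_nhdsWithin : Ioi (1 : ℝ) ∈ 𝓝[>] 1)).exists
  have ht1 : 1 < t := ht1
  refine ⟨lineMap y (p' : E) t, (interior_subset ht : g t ∈ _), ?_⟩
  rw [openSegment_eq_image_lineMap]
  refine ⟨t⁻¹, ⟨by positivity, inv_lt_one_of_one_lt₀ ht1⟩, ?_⟩
  rw [lineMap_lineMap_right, inv_mul_cancel₀ (by positivity), lineMap_apply_one]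

theorem IsExtreme.subset_of_mem_intrinsicInterior {P F F' : Set E} {p : E}
    (hF' : IsExtreme ℝ P F') (hF : F ⊆ P) (hp : p ∈ intrinsicInterior ℝ F) (hpF' : p ∈ F') :
    F ⊆ F' := by
  intro y hy
  obtain ⟨z, hz, hpz⟩ := exists_mem_openSegment_of_mem_intrinsicInterior hp hy
  exact hF'.left_mem_of_mem_openSegment (hF hy) (hF hz) hpF' hpz

theorem eq_singleton_of_mem_extremePoints_of_mem_intrinsicInterior {P F : Set E} {v : E}
    (hv : v ∈ P.extremePoints ℝ) (hF : F ⊆ P) (hvF : v ∈ intrinsicInterior ℝ F) : F = {v} :=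
  ((isExtreme_singleton.2 hv).subset_of_mem_intrinsicInterior hF hvF rfl).antisymm
    (singleton_subset_iff.2 (intrinsicInterior_subset hvF))

/-- The exposed faces of a polytope are determined by their vertices, so they are finite in
number. -/
theorem finite_setOf_isExposed {P S : Set E} (hS : S.Finite) (hP : P = convexHull ℝ S) :
    {F | IsExposed ℝ P F}.Finite := by
  have hcomp : IsCompact P := hP ▸ hS.isCompact_convexHull ℝ
  have hconv : Convex ℝ P := hP ▸ convex_convexHull ℝ S
  refine Finite.of_finite_image (f := fun F => F.extremePoints ℝ)
    (hS.finite_subsets.subset ?_) ?_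
  · rintro _ ⟨F, hF, rfl⟩
    refine (IsExposed.isExtreme hF).extremePoints_subset_extremePoints.trans ?_
    rw [hP]
    exact extremePoints_convexHull_subset
  · intro F hF F' hF' h
    have h : F.extremePoints ℝ = F'.extremePoints ℝ := h
    rw [← closure_convexHull_extremePoints (IsExposed.isCompact hF hcomp)
      (IsExposed.convex hF hconv), h, closure_convexHull_extremePoints
      (IsExposed.isCompact hF' hcomp) (IsExposed.convex hF' hconv)]

/-- The open star of `v` in a convex set `P`: the points of `P` all of whose faces contain `v`. -/
def vertexStar (P : Set E) (v : E) : Set E :=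
  {p ∈ P | ∀ F, IsExposed ℝ P F → p ∈ F → v ∈ F}

/-- What is removed from `P` is a union of finitely many closed faces, those missing `v`. -/
theorem vertexStar_mem_nhdsWithin {P S : Set E} (hS : S.Finite) (hP : P = convexHull ℝ S)
    {v p : E} (hp : p ∈ vertexStar P v) : vertexStar P v ∈ 𝓝[P] p := by
  have hclosed : IsClosed P := hP ▸ (hS.isCompact_convexHull ℝ).isClosed
  have hfin : {F | IsExposed ℝ P F ∧ v ∉ F}.Finite :=
    (finite_setOf_isExposed hS hP).subset fun F hF => hF.1
  have hopen : (⋃₀ {F | IsExposed ℝ P F ∧ v ∉ F})ᶜ ∈ 𝓝 p := by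
    refine IsOpen.mem_nhds ?_ ?_
    · rw [isOpen_compl_iff, sUnion_eq_biUnion]
      exact hfin.isClosed_biUnion fun F hF => hF.1.isClosed hclosed
    · rintro ⟨F, ⟨hF, hvF⟩, hpF⟩
      exact hvF (hp.2 F hF hpF)
  filter_upwards [self_mem_nhdsWithin, nhdsWithin_le_nhds hopen] with y hyP hy
  refine ⟨hyP, fun F hF hyF => ?_⟩
  by_contra hvF
  exact hy ⟨F, ⟨hF, hvF⟩, hyF⟩

theorem lineMap_mem_vertexStar {P : Set E} (hP : Convex ℝ P) {v p : E} (hv : v ∈ P)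
    (hp : p ∈ vertexStar P v) {c : ℝ} (hc : c ∈ Icc (0 : ℝ) 1) :
    lineMap v p c ∈ vertexStar P v := by
  refine ⟨hP.lineMap_mem hv hp.1 hc, fun F hF hcF => ?_⟩
  rcases hc.1.eq_or_lt with rfl | h0
  · simpa using hcF
  rcases hc.2.eq_or_lt with rfl | h1
  · exact hp.2 F hF (by simpa using hcF)
  · refine hF.isExtreme.left_mem_of_mem_openSegment hv hp.1 hcF ?_
    rw [openSegment_eq_image_lineMap]
    exact ⟨c, ⟨h0, h1⟩, rfl⟩

/-- The face with `p` in its relative interior lies in every face through `p`, so any of its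
vertices will do. -/
theorem exists_mem_vertexStar {P F : Set E} {p : E} (hP : IsCompact P) (hF : IsExposed ℝ P F)
    (hp : p ∈ intrinsicInterior ℝ F) : ∃ v ∈ P.extremePoints ℝ, p ∈ vertexStar P v := by
  obtain ⟨v, hv⟩ := (hF.isCompact hP).extremePoints_nonempty ⟨p, intrinsicInterior_subset hp⟩
  exact ⟨v, hF.isExtreme.extremePoints_subset_extremePoints hv,
    hF.subset (intrinsicInterior_subset hp), fun F' hF' hpF' =>
      hF'.isExtreme.subset_of_mem_intrinsicInterior hF.subset hp hpF' hv.1⟩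

/-- In the open star of `v`, moving towards `v` does not change the face in whose relative
interior a point lies. -/
theorem face_eq_of_lineMap {P F F' : Set E} (hP : Convex ℝ P) {v p : E} (hv : v ∈ P)
    (hp : p ∈ vertexStar P v) (hF : IsExposed ℝ P F) (hF' : IsExposed ℝ P F') {c : ℝ}
    (hc : c ∈ Ioc (0 : ℝ) 1) (hpF : p ∈ intrinsicInterior ℝ F)
    (hcF' : lineMap v p c ∈ intrinsicInterior ℝ F') : F = F' := by
  have hpF₁ := intrinsicInterior_subset hpF
  refine (hF'.isExtreme.subset_of_mem_intrinsicInterior hF.subset hpF ?_).antisymm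
    (hF.isExtreme.subset_of_mem_intrinsicInterior hF'.subset hcF'
      ((hF.convex hP).lineMap_mem (hp.2 F hF hpF₁) hpF₁ ⟨hc.1.le, hc.2⟩))
  have hcF₁ := intrinsicInterior_subset hcF'
  rcases hc.2.eq_or_lt with rfl | h1
  · simpa using hcF₁
  · refine hF'.isExtreme.left_mem_of_mem_openSegment hp.1 hv hcF₁ ?_
    rw [openSegment_symm, openSegment_eq_image_lineMap]
    exact ⟨c, ⟨hc.1, h1⟩, rfl⟩

end Faces

/-! ### One-parameter subgroups and orbit dimension -/

section TorusActions

variable {n : ℕ}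

theorem CompactTorus.exp_surjective : Function.Surjective (CompactTorus.exp (n := n)) := by
  intro t
  choose v hv using fun i => Circle.exp_surjective (t i)
  exact ⟨v, funext hv⟩

/-- Every one-parameter subgroup of the torus is of the form `s ↦ exp (s v)`. -/
theorem CompactTorus.exists_eq_exp_smul {φ : ℝ → CompactTorus n} (hφ : Continuous φ)
    (hadd : ∀ s t, φ (s + t) = φ s * φ t) :
    ∃ v : Fin n → ℝ, ∀ s, φ s = CompactTorus.exp (s • v) := by
  have h (i : Fin n) : ∃ c : ℝ, ∀ s, φ s i = Circle.exp (c * s) :=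
    Circle.exists_eq_exp_mul (φ := fun s => φ s i) (by fun_prop)
      fun s t => congrFun (hadd s t) i
  choose v hv using h
  refine ⟨v, fun s => funext fun i => ?_⟩
  rw [hv, CompactTorus.exp, Pi.smul_apply, smul_eq_mul, mul_comm]

variable {M : Type*} [MulAction (CompactTorus n) M]

theorem orbitDim_eq_zero_iff {x : M} :
    orbitDim (n := n) x = 0 ↔ x ∈ MulAction.fixedPoints (CompactTorus n) M := by
  rw [orbitDim, Module.finrank_zero_iff, Submodule.Quotient.subsingleton_iff,
    Submodule.eq_top_iff']
  refine ⟨fun h t => ?_, fun h v s => h _⟩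
  obtain ⟨v, rfl⟩ := CompactTorus.exp_surjective t
  simpa using h v 1

theorem stabilizerLieAlgebra_eq_of_le {x y : M}
    (h : stabilizerLieAlgebra (n := n) x ≤ stabilizerLieAlgebra y)
    (hxy : orbitDim (n := n) x = orbitDim (n := n) y) :
    stabilizerLieAlgebra (n := n) x = stabilizerLieAlgebra y := by
  refine Submodule.eq_of_le_of_finrank_eq h ?_
  have hx := Submodule.finrank_quotient_add_finrank (stabilizerLieAlgebra (n := n) x)
  have hy := Submodule.finrank_quotient_add_finrank (stabilizerLieAlgebra (n := n) y)
  unfold orbitDim at hxy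
  omega

end TorusActions

/-! ### Equivariant charts and local sections -/

section EquivariantCharts

variable {n : ℕ} {M : Type*} [TopologicalSpace M] [MulAction (CompactTorus n) M]

/-- A chart into `ℂⁿ` with invariant source that is equivariant up to the automorphism `δ`. -/
def IsEquivariantChart (ψ : OpenPartialHomeomorph M (Fin n → ℂ))
    (δ : CompactTorus n ≃ₜ* CompactTorus n) : Prop :=
  ∀ (t : CompactTorus n), ∀ x ∈ ψ.source,
    t • x ∈ ψ.source ∧ ψ (t • x) = fun i => (δ t i : ℂ) * ψ x i

variable {ψ : OpenPartialHomeomorph M (Fin n → ℂ)} {δ : CompactTorus n ≃ₜ* CompactTorus n}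

theorem IsEquivariantChart.smul_eq_self_iff (h : IsEquivariantChart ψ δ) {x : M}
    (hx : x ∈ ψ.source) {t : CompactTorus n} :
    t • x = x ↔ ∀ i, ψ x i ≠ 0 → δ t i = 1 := by
  rw [← ψ.injOn.eq_iff (h t x hx).1 hx, (h t x hx).2, funext_iff]
  refine forall_congr' fun i => ?_
  by_cases h0 : ψ x i = 0 <;> simp [h0, Circle.ext_iff]

/-- The dimension of the orbit determines the number of nonvanishing coordinates. -/
theorem IsEquivariantChart.ne_zero_of_orbitDim_eq (h : IsEquivariantChart ψ δ) {x y : M}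
    (hx : x ∈ ψ.source) (hy : y ∈ ψ.source) (hxy : ∀ i, ψ x i ≠ 0 → ψ y i ≠ 0)
    (hdim : orbitDim (n := n) x = orbitDim (n := n) y) {i : Fin n} (hi : ψ y i ≠ 0) :
    ψ x i ≠ 0 := by
  intro hxi
  have hle : stabilizerLieAlgebra (n := n) y ≤ stabilizerLieAlgebra x := fun v hv s =>
    (h.smul_eq_self_iff hx).2 fun j hj => (h.smul_eq_self_iff hy).1 (hv s) j (hxy j hj)
  have heq := stabilizerLieAlgebra_eq_of_le hle hdim.symm
  -- This subgroup rotates only the `i`-th chart coordinate, so it fixes `x`. Equality of the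
  -- stabilizer Lie algebras makes it fix `y`, yet at time `π` it negates the nonzero coordinate `ψ
  -- y i`.
  let φ : ℝ → CompactTorus n := fun s => δ.symm (Pi.mulSingle i (Circle.exp s))
  have hφ : Continuous φ := δ.symm.continuous.comp
    ((continuous_mulSingle i).comp Circle.exp.continuous)
  obtain ⟨v, hv⟩ := CompactTorus.exists_eq_exp_smul hφ fun s t => by
    simp only [φ, Circle.exp_add, Pi.mulSingle_mul, map_mul]
  have hδ (s : ℝ) : δ (CompactTorus.exp (s • v)) = Pi.mulSingle i (Circle.exp s) := by
    rw [← hv]; exact δ.apply_symm_apply _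
  have hvx : v ∈ stabilizerLieAlgebra (n := n) x := fun s =>
    (h.smul_eq_self_iff hx).2 fun j hj => by
      rw [hδ, Pi.mulSingle_eq_of_ne]
      rintro rfl
      exact hj hxi
  have h1 := (h.smul_eq_self_iff hy).1 ((heq ▸ hvx : v ∈ stabilizerLieAlgebra (n := n) y) Real.pi)
    i hi
  rw [hδ, Pi.mulSingle_eq_same] at h1
  have h2 := congrArg (fun z : Circle => (z : ℂ)) h1
  norm_num at h2

/-- Rotating each coordinate by minus its argument stays in the orbit, and the source is invariant.
-/
theorem IsEquivariantChart.norm_mem_target (h : IsEquivariantChart ψ δ) {x : M}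
    (hx : x ∈ ψ.source) :
    (fun i => (‖ψ x i‖ : ℂ)) ∈ ψ.target ∧
      ∃ t : CompactTorus n, t • x = ψ.symm fun i => (‖ψ x i‖ : ℂ) := by
  have hc (i : Fin n) : ∃ c : Circle, (c : ℂ) * ψ x i = ‖ψ x i‖ := by
    refine ⟨Circle.exp (-(ψ x i).arg), ?_⟩
    nth_rw 2 [← Complex.norm_mul_exp_arg_mul_I (ψ x i)]
    rw [Circle.coe_exp, mul_left_comm, ← Complex.exp_add]
    simp
  choose c hc using hc
  have ht := h (δ.symm c) x hx
  have hval : ψ (δ.symm c • x) = fun i => (‖ψ x i‖ : ℂ) := by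
    rw [ht.2]
    funext i
    rw [show δ (δ.symm c) = c from δ.apply_symm_apply c, hc]
  refine ⟨hval ▸ ψ.map_source ht.1, δ.symm c, ?_⟩
  rw [← hval, ψ.left_inv ht.1]

variable {E : Type*} [TopologicalSpace E]

/-- `q` is a closed map, and the complement of `A` is a union of fibres. -/
theorem exists_isOpen_preimage_subset [T2Space E] [CompactSpace M] {q : M → E}
    (hq : Continuous q)
    (hfib : ∀ x y : M, q x = q y ↔ x ∈ MulAction.orbit (CompactTorus n) y) {A : Set M}
    (hA : IsOpen A) (hinv : ∀ (t : CompactTorus n), ∀ x ∈ A, t • x ∈ A) {x : M} (hx : x ∈ A) :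
    ∃ O : Set E, IsOpen O ∧ q x ∈ O ∧ q ⁻¹' O ⊆ A := by
  refine ⟨(q '' Aᶜ)ᶜ, (hA.isClosed_compl.isCompact.image hq).isClosed.isOpen_compl, ?_, ?_⟩
  · rintro ⟨y, hy, hyx⟩
    obtain ⟨t, rfl⟩ := (hfib y x).1 hyx
    exact hy (hinv t x hx)
  · intro y hy
    by_contra hyA
    exact hy ⟨y, hyA, rfl⟩

/-- Equivariant charts give rise to local sections of the orbit projection. -/
theorem IsEquivariantChart.exists_section [T2Space E] [CompactSpace M] {q : M → E}
    (hq : Continuous q)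
    (hfib : ∀ x y : M, q x = q y ↔ x ∈ MulAction.orbit (CompactTorus n) y)
    (h : IsEquivariantChart ψ δ) {x₀ : M} (hx₀ : x₀ ∈ ψ.source) :
    ∃ (O : Set E) (σ : E → M), IsOpen O ∧ q x₀ ∈ O ∧ ContinuousOn σ (O ∩ range q) ∧
      ∀ p ∈ O ∩ range q, σ p ∈ ψ.source ∧ q (σ p) = p := by
  classical
  obtain ⟨O, hO, hx₀O, hOsub⟩ := exists_isOpen_preimage_subset hq hfib ψ.open_source
    (fun t x hx => (h t x hx).1) hx₀
  -- `r` picks the point of the orbit with nonnegative real coordinates. It is constant on orbits,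
  -- so it descends along `q` to the section.
  let r : M → M := fun x => ψ.symm fun i => (‖ψ x i‖ : ℂ)
  have hr : ContinuousOn r ψ.source := by
    refine ψ.continuousOn_symm.comp ?_ fun x hx => (h.norm_mem_target hx).1
    have := ψ.continuousOn
    fun_prop
  have hrinv (t : CompactTorus n) (x : M) (hx : x ∈ ψ.source) : r (t • x) = r x := by
    simp only [r, (h t x hx).2, norm_mul, Circle.norm_coe, one_mul]
  have hrsource (x : M) (hx : x ∈ ψ.source) : r x ∈ ψ.source :=
    ψ.map_target (h.norm_mem_target hx).1
  have hqr (x : M) (hx : x ∈ ψ.source) : q (r x) = q x := by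
    obtain ⟨t, ht⟩ := (h.norm_mem_target hx).2
    exact (hfib _ _).2 ⟨t, ht⟩
  let σ : E → M := fun p => if hp : p ∈ range q then r hp.choose else x₀
  have hσ (x : M) (hx : x ∈ ψ.source) : σ (q x) = r x := by
    have hp : q x ∈ range q := ⟨x, rfl⟩
    obtain ⟨t, ht⟩ := (hfib _ _).1 hp.choose_spec
    simp only [σ, dif_pos hp]
    rw [← hrinv t x hx]
    exact congrArg r ht.symm
  refine ⟨O, σ, hO, hx₀O, ?_, ?_⟩
  · rintro _ ⟨hpO, x, rfl⟩
    have hx : x ∈ ψ.source := hOsub hpO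
    rw [ContinuousWithinAt, tendsto_nhds]
    intro B hB hxB
    rw [hσ x hx] at hxB
    obtain ⟨O', hO', hxO', hO'sub⟩ := exists_isOpen_preimage_subset hq hfib
      (hr.isOpen_inter_preimage ψ.open_source hB)
      (fun t y hy => ⟨(h t y hy.1).1, by rw [mem_preimage, hrinv t y hy.1]; exact hy.2⟩)
      (⟨hx, hxB⟩ : x ∈ ψ.source ∩ r ⁻¹' B)
    filter_upwards [self_mem_nhdsWithin, nhdsWithin_le_nhds (hO'.mem_nhds hxO')]
    rintro _ ⟨-, y, rfl⟩ hy
    rw [mem_preimage, hσ y (hO'sub hy).1]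
    exact (hO'sub hy).2
  · rintro _ ⟨hpO, x, rfl⟩
    rw [hσ x (hOsub hpO)]
    exact ⟨hrsource x (hOsub hpO), hqr x (hOsub hpO)⟩

end EquivariantCharts

/-! ### Lifting homotopies of the orbit space -/

/-- Equivariant covering of a homotopy of the base that is supported in the domain of a section
and along which the stabilizers of the section do not shrink. -/
theorem exists_equivariant_lift_of_section {G M E : Type*} [Group G] [TopologicalSpace G]
    [CompactSpace G] [TopologicalSpace M] [T2Space M] [MulAction G M] [ContinuousSMul G M]
    [TopologicalSpace E] {q : M → E} (hq : Continuous q)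
    (hfib : ∀ x y : M, q x = q y ↔ x ∈ MulAction.orbit G y)
    {O K : Set E} (hO : IsOpen O) (hK : IsClosed K) (hKO : K ⊆ O) {σ : E → M}
    (hσ : ContinuousOn σ (O ∩ range q)) (hqσ : ∀ p ∈ O ∩ range q, q (σ p) = p)
    {f : E × unitInterval → E} (hf : Continuous f) (hf0 : ∀ p, f (p, 0) = p)
    (hfK : ∀ p ∉ K, ∀ t, f (p, t) = p)
    (hfO : ∀ p ∈ O ∩ range q, ∀ t, f (p, t) ∈ O ∩ range q)
    (hstab : ∀ p ∈ O ∩ range q, ∀ t, ∀ g : G, g • σ p = σ p → g • σ (f (p, t)) = σ (f (p, t))) :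
    ∃ H : C(M × unitInterval, M), (∀ (g : G) x t, H (g • x, t) = g • H (x, t)) ∧
      (∀ x, H (x, 0) = x) ∧ ∀ x t, q (H (x, t)) = f (q x, t) := by
  classical
  have hex (x : M) : ∃ g : G, q x ∈ O → g • σ (q x) = x := by
    by_cases hx : q x ∈ O
    · obtain ⟨g, hg⟩ := (hfib x (σ (q x))).1 (hqσ _ ⟨hx, x, rfl⟩).symm
      exact ⟨g, fun _ => hg⟩
    · exact ⟨1, fun h => absurd h hx⟩
  choose γ hγ using hex
  let H : M × unitInterval → M := fun y => if q y.1 ∈ O then γ y.1 • σ (f (q y.1, y.2)) else y.1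
  have hqinv (g : G) (x : M) : q (g • x) = q x := (hfib _ _).2 ⟨g, rfl⟩
  -- The choice of `γ x` is immaterial: two choices differ by an element of the stabilizer of `σ (q
  -- x)`, which fixes `σ (f (q x, t))`.
  have hH (x : M) (t : unitInterval) (hx : q x ∈ O) (g : G) (hg : g • σ (q x) = x) :
      H (x, t) = g • σ (f (q x, t)) := by
    have h1 : (g⁻¹ * γ x) • σ (q x) = σ (q x) := by
      rw [mul_smul, hγ x hx, inv_smul_eq_iff, hg]
    have h2 := hstab _ ⟨hx, x, rfl⟩ t _ h1
    rw [mul_smul, inv_smul_eq_iff] at h2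
    simp only [H, if_pos hx, h2]
  have hHK (x : M) (t : unitInterval) (hx : q x ∉ K) : H (x, t) = x := by
    by_cases hxO : q x ∈ O
    · rw [hH x t hxO _ (hγ x hxO), hfK _ hx, hγ x hxO]
    · simp only [H, if_neg hxO]
  have hHc : Continuous H := by
    rw [continuous_iff_continuousAt]
    rintro ⟨x, t⟩
    by_cases hx : q x ∈ O
    -- `γ` need not be continuous, but along an ultrafilter it converges by compactness of `G`. Its
    -- limit `g` again satisfies `g • σ (q x) = x`, so `hH` computes `H (x, t)` with it.
    · rw [continuousAt_iff_ultrafilter]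
      intro U hU
      have hfst : Tendsto Prod.fst (U : Filter (M × unitInterval)) (𝓝 x) :=
        continuous_fst.continuousAt.mono_left hU
      have hev : ∀ᶠ y in (U : Filter (M × unitInterval)), q y.1 ∈ O :=
        (hq.continuousAt.tendsto.comp hfst).eventually_mem (hO.mem_nhds hx)
      obtain ⟨g, -, hg⟩ := isCompact_univ.ultrafilter_le_nhds (U.map fun y => γ y.1) (by simp)
      have hγU : Tendsto (fun y : M × unitInterval => γ y.1) U (𝓝 g) := hg
      have hqU : Tendsto (fun y : M × unitInterval => q y.1) U (𝓝[O ∩ range q] (q x)) :=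
        tendsto_nhdsWithin_iff.2 ⟨hq.continuousAt.tendsto.comp hfst,
          hev.mono fun y hy => ⟨hy, y.1, rfl⟩⟩
      have hfU : Tendsto (fun y : M × unitInterval => f (q y.1, y.2)) U
          (𝓝[O ∩ range q] (f (q x, t))) := by
        refine tendsto_nhdsWithin_iff.2 ⟨?_, hev.mono fun y hy => hfO _ ⟨hy, y.1, rfl⟩ _⟩
        have hc : Continuous fun y : M × unitInterval => f (q y.1, y.2) := by fun_prop
        exact (hc.tendsto (x, t)).mono_left hU
      have hxg : g • σ (q x) = x := by
        refine tendsto_nhds_unique ((hγU.smul ((hσ _ ⟨hx, x, rfl⟩).tendsto.comp hqU))) ?_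
        exact hfst.congr' (hev.mono fun y hy => (hγ y.1 hy).symm)
      rw [hH x t hx g hxg]
      refine (hγU.smul ((hσ _ (hfO _ ⟨hx, x, rfl⟩ t)).tendsto.comp hfU)).congr' ?_
      exact hev.mono fun y hy => (hH y.1 y.2 hy _ (hγ y.1 hy)).symm
    · have hev : ∀ᶠ y : M × unitInterval in 𝓝 (x, t), q y.1 ∉ K :=
        (hK.isOpen_compl.preimage (hq.comp continuous_fst)).mem_nhds fun h => hx (hKO h)
      exact continuous_fst.continuousAt.congr (hev.mono fun y hy => (hHK y.1 y.2 hy).symm)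
  refine ⟨⟨H, hHc⟩, fun g x t => ?_, fun x => ?_, fun x t => ?_⟩ <;> simp only [ContinuousMap.coe_mk]
  · by_cases hx : q x ∈ O
    · rw [hH x t hx _ (hγ x hx), hH (g • x) t (by rwa [hqinv]) (g * γ x)
        (by rw [hqinv, mul_smul, hγ x hx]), hqinv, mul_smul]
    · rw [hHK x t fun h => hx (hKO h), hHK (g • x) t fun h => hx (hKO (by rwa [hqinv] at h))]
  · by_cases hx : q x ∈ O
    · rw [hH x 0 hx _ (hγ x hx), hf0, hγ x hx]
    · exact hHK x 0 fun h => hx (hKO h)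
  · by_cases hx : q x ∈ O
    · rw [hH x t hx _ (hγ x hx), hqinv, hqσ _ (hfO _ ⟨hx, x, rfl⟩ t)]
    · have hxK : q x ∉ K := fun h => hx (hKO h)
      rw [hHK x t hxK, hfK _ hxK]

/-! ### Radial homotopies -/

section RadialHomotopies

variable (G : Type*) {M E : Type*} [Group G] [TopologicalSpace M] [MulAction G M]
  [NormedAddCommGroup E] [NormedSpace ℝ E]

/-- An equivariant homotopy of `M`, starting at the identity, that covers a motion of the base
along the segments towards `v`. -/
structure IsRadialHomotopy (q : M → E) (v : E) (H : C(M × unitInterval, M)) : Prop where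
  smul : ∀ (g : G) x t, H (g • x, t) = g • H (x, t)
  zero : ∀ x, H (x, 0) = x
  radial : ∀ x t, ∃ c ∈ Icc (0 : ℝ) 1, q (H (x, t)) = lineMap v (q x) c

/-- The preimage of the cone from `v` over `W` can be moved by a radial homotopy into the fibre
over `v`. -/
def IsRadiallyContractible (q : M → E) (v : E) (W : Set E) : Prop :=
  ∃ H : C(M × unitInterval, M), IsRadialHomotopy G q v H ∧
    ∀ x, ∀ y ∈ W, ∀ c ∈ Icc (0 : ℝ) 1, q x = lineMap v y c → q (H (x, 1)) = v

variable {G} {q : M → E} {v : E}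

theorem IsRadialHomotopy.comp {H₁ H₂ : C(M × unitInterval, M)} (h₂ : IsRadialHomotopy G q v H₂)
    (h₁ : IsRadialHomotopy G q v H₁) :
    IsRadialHomotopy G q v (H₂.comp (H₁.prodMk ContinuousMap.snd)) where
  smul g x t := by simp [h₁.smul, h₂.smul]
  zero x := by simp [h₁.zero, h₂.zero]
  radial x t := by
    obtain ⟨c, hc, h⟩ := h₁.radial x t
    obtain ⟨d, hd, h'⟩ := h₂.radial (H₁ (x, t)) t
    refine ⟨c * d, ⟨mul_nonneg hc.1 hd.1, mul_le_one₀ hc.2 hd.1 hd.2⟩, ?_⟩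
    simp [h, h', lineMap_lineMap_right, mul_comm]

theorem IsRadiallyContractible.mono {W W' : Set E} (h : IsRadiallyContractible G q v W)
    (hW : W' ⊆ W) : IsRadiallyContractible G q v W' :=
  let ⟨H, hH, hHW⟩ := h
  ⟨H, hH, fun x y hy => hHW x y (hW hy)⟩

theorem isRadiallyContractible_empty : IsRadiallyContractible G q v ∅ :=
  ⟨ContinuousMap.fst, ⟨fun _ _ _ => rfl, fun _ => rfl,
    fun x _ => ⟨1, by simp, (lineMap_apply_one v (q x)).symm⟩⟩, fun _ _ h => h.elim⟩

/-- A radial motion keeps the fibre over `v` and every cone from `v` invariant, so neither homotopy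
spoils the other. This is why contractibility is asked on the cone. -/
theorem IsRadiallyContractible.union {W W' : Set E} (h : IsRadiallyContractible G q v W)
    (h' : IsRadiallyContractible G q v W') : IsRadiallyContractible G q v (W ∪ W') := by
  obtain ⟨H, hH, hHW⟩ := h
  obtain ⟨H', hH', hHW'⟩ := h'
  refine ⟨_, hH'.comp hH, fun x y hy c hc hx => ?_⟩
  simp only [ContinuousMap.comp_apply, ContinuousMap.prod_eval, ContinuousMap.snd_apply]
  rcases hy with hy | hy
  · obtain ⟨d, -, h⟩ := hH'.radial (H (x, 1)) 1
    rw [h, hHW x y hy c hc hx, lineMap_same_apply]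
  · obtain ⟨d, hd, h⟩ := hH.radial x 1
    refine hHW' _ y hy (d * c) ⟨mul_nonneg hd.1 hc.1, mul_le_one₀ hd.2 hc.1 hc.2⟩ ?_
    rw [h, hx, lineMap_lineMap_right]

variable (G) in
/-- A local section of `q` over `O` (within the open star of `v`) whose stabilizers do not shrink
when moving towards `v`. -/
structure IsStarSection (P : Set E) (q : M → E) (v : E) (O : Set E) (σ : E → M) : Prop where
  isOpen : IsOpen O
  subset_star : O ∩ P ⊆ vertexStar P v
  continuousOn : ContinuousOn σ (O ∩ P)
  proj : ∀ p ∈ O ∩ P, q (σ p) = p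
  stab : ∀ p ∈ O ∩ P, ∀ c ∈ Icc (0 : ℝ) 1, (∀ c' ∈ Icc c 1, lineMap v p c' ∈ O) →
    ∀ g : G, g • σ p = σ p → g • σ (lineMap v p c) = σ (lineMap v p c)

theorem IsStarSection.mono {P O O' : Set E} {σ : E → M} (h : IsStarSection G P q v O σ)
    (hO' : IsOpen O') (hsub : O' ⊆ O) : IsStarSection G P q v O' σ where
  isOpen := hO'
  subset_star := (inter_subset_inter_left P hsub).trans h.subset_star
  continuousOn := h.continuousOn.mono (inter_subset_inter_left P hsub)
  proj p hp := h.proj p ⟨hsub hp.1, hp.2⟩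
  stab p hp c hc hseg := h.stab p ⟨hsub hp.1, hp.2⟩ c hc fun c' hc' => hsub (hseg c' hc')

theorem continuous_lineMap_left (v : E) : Continuous fun y : E × ℝ => lineMap v y.1 y.2 := by
  simp only [lineMap_apply_module]
  fun_prop

theorem exists_forall_lineMap_mem (v : E) {z : E} {O : Set E} (hO : O ∈ 𝓝 z) :
    ∃ r > 0, ∃ η ∈ Ioc (0 : ℝ) 1, ∀ y ∈ Metric.closedBall z r, ∀ c ∈ Icc (1 - η) 1,
      lineMap v y c ∈ O := by
  have h : ∀ᶠ y : E × ℝ in 𝓝 (z, 1), lineMap v y.1 y.2 ∈ O :=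
    (continuous_lineMap_left v).continuousAt.eventually_mem (by simpa using hO)
  obtain ⟨ε, hε, hball⟩ := Metric.nhds_basis_closedBall.mem_iff.1 h
  refine ⟨ε, hε, min ε 1, ⟨lt_min hε one_pos, min_le_right _ _⟩, fun y hy c hc => ?_⟩
  refine hball (a := (y, c)) ?_
  rw [Metric.mem_closedBall, Prod.dist_eq, max_le_iff]
  refine ⟨hy, ?_⟩
  rw [Real.dist_eq, abs_le]
  have := min_le_left ε 1
  constructor <;> linarith [hc.1, hc.2]

variable [TopologicalSpace G] [CompactSpace G] [T2Space M] [ContinuousSMul G M]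

/-- The cut-off `lam` confines the motion to `K`, where the section lives; `a` is the largest
fraction of the way to `v` that is travelled. -/
theorem IsStarSection.exists_radialHomotopy {P O K : Set E} {σ : E → M}
    (h : IsStarSection G P q v O σ) (hP : Convex ℝ P) (hvP : v ∈ P) (hq : Continuous q)
    (hrange : range q = P) (hfib : ∀ x y : M, q x = q y ↔ x ∈ MulAction.orbit G y)
    (hK : IsClosed K) (hKO : K ⊆ O) {lam : E → ℝ} (hlam : Continuous lam)
    (hlam01 : ∀ y, lam y ∈ Icc (0 : ℝ) 1) (hlamK : ∀ y ∉ K, lam y = 0) {a : ℝ}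
    (ha : a ∈ Icc (0 : ℝ) 1) (hmove : ∀ y ∈ K, ∀ c ∈ Icc (1 - a) 1, lineMap v y c ∈ O) :
    ∃ H : C(M × unitInterval, M), IsRadialHomotopy G q v H ∧
      ∀ x, q (H (x, 1)) = lineMap v (q x) (1 - a * lam (q x)) := by
  have hc (y : E) (t : unitInterval) : 1 - t * (a * lam y) ∈ Icc (1 - a) 1 := by
    have h1 := mul_nonneg ha.1 (hlam01 y).1
    have h2 := mul_le_of_le_one_right ha.1 (hlam01 y).2
    have h3 := mul_nonneg t.2.1 h1
    have h4 := mul_le_of_le_one_left h1 t.2.2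
    constructor <;> linarith
  have hc01 (y : E) (t : unitInterval) : 1 - t * (a * lam y) ∈ Icc (0 : ℝ) 1 :=
    ⟨by linarith [(hc y t).1, ha.2], (hc y t).2⟩
  have hzero (y : E) (hy : y ∉ K) (c : unitInterval) :
      lineMap v y (1 - (c : ℝ) * (a * lam y)) = y := by
    simp [hlamK y hy]
  have hseg (y : E) (hy : y ∈ O) (t : unitInterval) :
      ∀ c' ∈ Icc (1 - (t : ℝ) * (a * lam y)) 1, lineMap v y c' ∈ O := by
    intro c' hc'
    by_cases hyK : y ∈ K
    · exact hmove y hyK c' ⟨(hc y t).1.trans hc'.1, hc'.2⟩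
    · rw [hlamK y hyK, mul_zero, mul_zero, sub_zero] at hc'
      rw [le_antisymm hc'.2 hc'.1, lineMap_apply_one]
      exact hy
  obtain ⟨H, hsmul, h0, hqH⟩ := exists_equivariant_lift_of_section (G := G) hq hfib h.isOpen hK hKO
    (σ := σ) (by rw [hrange]; exact h.continuousOn) (by rw [hrange]; exact h.proj)
    (f := fun y => lineMap v y.1 (1 - (y.2 : ℝ) * (a * lam y.1)))
    ((continuous_lineMap_left v).comp (f := fun y : E × unitInterval =>
      (y.1, 1 - (y.2 : ℝ) * (a * lam y.1))) (by fun_prop))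
    (fun p => by simp) hzero
    (fun p hp t => ⟨hseg p hp.1 t _ ⟨le_rfl, (hc p t).2⟩,
      hrange ▸ hP.lineMap_mem hvP (hrange ▸ hp.2) (hc01 p t)⟩)
    (fun p hp t g hg => h.stab p (hrange ▸ hp) _ (hc01 p t) (hseg p hp.1 t) g hg)
  refine ⟨H, ⟨hsmul, h0, fun x t => ⟨_, hc01 (q x) t, hqH x t⟩⟩, fun x => ?_⟩
  simpa using hqH x 1

end RadialHomotopies

/-! ### Contracting neighbourhoods to a vertex -/

section Contractions

variable {G M E : Type*} [Group G] [TopologicalSpace M] [MulAction G M]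
  [NormedAddCommGroup E] [InnerProductSpace ℝ E] [FiniteDimensional ℝ E] {q : M → E} {v : E}
  [TopologicalSpace G] [CompactSpace G] [T2Space M] [ContinuousSMul G M]

theorem IsStarSection.isRadiallyContractible_vertex {P O : Set E} {σ : E → M}
    (h : IsStarSection G P q v O σ) (hP : Convex ℝ P) (hvP : v ∈ P) (hq : Continuous q)
    (hrange : range q = P) (hfib : ∀ x y : M, q x = q y ↔ x ∈ MulAction.orbit G y)
    (hvO : v ∈ O) : ∃ W ∈ 𝓝 v, IsRadiallyContractible G q v W := by
  obtain ⟨r, hr, hrO⟩ := Metric.isOpen_iff.1 h.isOpen v hvO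
  -- Balls about `v` contain their cones. On the inner one the cut-off is `1`, so with `a = 1` it
  -- collapses onto `v`.
  let b : ContDiffBump v := ⟨r / 4, r / 2, by positivity, by linarith⟩
  obtain ⟨H, hH, hH1⟩ := (h.mono Metric.isOpen_ball hrO).exists_radialHomotopy hP hvP hq hrange hfib
    (K := Metric.closedBall v (r / 2)) Metric.isClosed_closedBall
    (Metric.closedBall_subset_ball (by linarith)) b.continuous (fun y => ⟨b.nonneg, b.le_one⟩)
    (fun y hy => b.zero_of_le_dist (not_le.1 hy).le) (a := 1) ⟨zero_le_one, le_rfl⟩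
    (fun y hy c hc => (convex_ball v r).lineMap_mem (Metric.mem_ball_self hr)
      (Metric.closedBall_subset_ball (by linarith) hy) ⟨by linarith [hc.1], hc.2⟩)
  refine ⟨Metric.closedBall v (r / 4), Metric.closedBall_mem_nhds v (by positivity), H, hH,
    fun x y hy c hc hx => ?_⟩
  have hqx : q x ∈ Metric.closedBall v (r / 4) := hx ▸
    (convex_closedBall v (r / 4)).lineMap_mem (Metric.mem_closedBall_self (by positivity)) hy hc
  rw [hH1, b.one_of_mem_closedBall hqx]
  simp

/-- A neighbourhood of `z` is first pushed by the factor `c` into `W`, and then the contraction of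
`W` is applied. -/
theorem IsStarSection.isRadiallyContractible_step {P O : Set E} {σ : E → M}
    (h : IsStarSection G P q v O σ) (hP : Convex ℝ P) (hvP : v ∈ P) (hq : Continuous q)
    (hrange : range q = P) (hfib : ∀ x y : M, q x = q y ↔ x ∈ MulAction.orbit G y)
    {z : E} (hzO : z ∈ O) :
    ∃ η ∈ Ioc (0 : ℝ) 1, ∀ c ∈ Ioo (1 - η) 1,
      (∃ W ∈ 𝓝 (lineMap v z c), IsRadiallyContractible G q v W) →
      ∃ W ∈ 𝓝 z, IsRadiallyContractible G q v W := by
  obtain ⟨r, hr, η, hη, hmove⟩ := exists_forall_lineMap_mem v (h.isOpen.mem_nhds hzO)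
  obtain ⟨r', hr', η', hη', hmove'⟩ := exists_forall_lineMap_mem v
    (Metric.closedBall_mem_nhds z (half_pos hr))
  let b : ContDiffBump z := ⟨r / 2, r, half_pos hr, half_lt_self hr⟩
  refine ⟨min η η', ⟨lt_min hη.1 hη'.1, (min_le_left _ _).trans hη.2⟩, ?_⟩
  rintro c₀ hc₀ ⟨W, hW, H, hH, hHW⟩
  have hη₁ := min_le_left η η'
  have hη₂ := min_le_right η η'
  have hc₀0 : 0 < c₀ := by linarith [hc₀.1, hη.2]
  obtain ⟨L, hL, hL1⟩ := h.exists_radialHomotopy hP hvP hq hrange hfib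
    (K := Metric.closedBall z r) Metric.isClosed_closedBall
    (fun y hy => by simpa using hmove y hy 1 ⟨by linarith [hη.1], le_rfl⟩)
    b.continuous (fun y => ⟨b.nonneg, b.le_one⟩)
    (fun y hy => b.zero_of_le_dist (not_le.1 hy).le) (a := 1 - c₀)
    ⟨by linarith [hc₀.2], by linarith⟩
    (fun y hy c hc => hmove y hy c ⟨by linarith [hc.1, hc₀.1], hc.2⟩)
  have hcont : Continuous fun y : E => lineMap v y c₀ :=
    (continuous_lineMap_left v).comp (f := fun y : E => (y, c₀)) (by fun_prop)
  refine ⟨_, inter_mem (Metric.closedBall_mem_nhds z hr') (hcont.continuousAt.preimage_mem_nhds hW),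
    _, hH.comp hL, ?_⟩
  rintro x y ⟨hy, hyW⟩ c hc hx
  simp only [ContinuousMap.comp_apply, ContinuousMap.prod_eval, ContinuousMap.snd_apply]
  -- For `c₀ ≤ c` the point is close to `z`, where the push is by exactly `c₀`. For `c < c₀` it is
  -- already on the cone over `W`, which the push preserves.
  rcases le_or_gt c₀ c with hcc | hcc
  · refine hHW _ _ hyW c hc ?_
    have hqx : q x ∈ Metric.closedBall z (r / 2) :=
      hx ▸ hmove' y hy c ⟨by linarith [hc₀.1], hc.2⟩
    rw [hL1, b.one_of_mem_closedBall hqx, hx, lineMap_lineMap_right, lineMap_lineMap_right]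
    ring_nf
  · obtain ⟨d, hd, hLx⟩ := hL.radial x 1
    refine hHW _ _ hyW (d * c / c₀) ⟨by have := hd.1; have := hc.1; positivity, ?_⟩ ?_
    · rw [div_le_one hc₀0]
      exact (mul_le_of_le_one_left hc.1 hd.2).trans hcc.le
    · rw [hLx, hx, lineMap_lineMap_right, lineMap_lineMap_right, div_mul_cancel₀ _ hc₀0.ne']

theorem exists_isRadiallyContractible_nhds {P : Set E} (hP : Convex ℝ P) (hvP : v ∈ P)
    (hq : Continuous q) (hrange : range q = P)
    (hfib : ∀ x y : M, q x = q y ↔ x ∈ MulAction.orbit G y)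
    (hsec : ∀ z ∈ vertexStar P v, ∃ O σ, z ∈ O ∧ IsStarSection G P q v O σ)
    {p : E} (hp : p ∈ vertexStar P v) : ∃ W ∈ 𝓝 p, IsRadiallyContractible G q v W := by
  let A : Set E := {z | ∃ W ∈ 𝓝 z, IsRadiallyContractible G q v W}
  have hA : IsOpen A := isOpen_iff_eventually.2 fun z ⟨W, hW, hWc⟩ =>
    (eventually_mem_nhds_iff.2 hW).mono fun y hy => ⟨W, hy, hWc⟩
  have hB : IsCompact (Icc (0 : ℝ) 1 ∩ (fun s : ℝ => lineMap v p s) ⁻¹' Aᶜ) :=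
    isCompact_Icc.inter_right (hA.isClosed_compl.preimage lineMap_continuous)
  by_contra hpA
  -- Continuous induction along the segment: the first bad point `s` is not `v`, and the good points
  -- just before it make it good.
  obtain ⟨s, ⟨hs, hsA⟩, hleast⟩ := hB.exists_isLeast ⟨1, by simp, by
    rw [mem_preimage, lineMap_apply_one]; exact hpA⟩
  have hstar (c : ℝ) (hc : c ∈ Icc (0 : ℝ) 1) := lineMap_mem_vertexStar hP hvP hp hc
  have hs0 : 0 < s := by
    refine hs.1.lt_of_ne ?_
    rintro rfl
    obtain ⟨O, σ, hvO, hσ⟩ := hsec _ (hstar 0 (by simp))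
    rw [lineMap_apply_zero] at hvO
    refine hsA ?_
    simp only [lineMap_apply_zero]
    exact hσ.isRadiallyContractible_vertex hP hvP hq hrange hfib hvO
  obtain ⟨O, σ, hzO, hσ⟩ := hsec _ (hstar s hs)
  obtain ⟨η, hη, hstep⟩ := hσ.isRadiallyContractible_step hP hvP hq hrange hfib hzO
  refine hsA (hstep (1 - η / 2) ⟨by linarith [hη.1], by linarith [hη.1]⟩ ?_)
  rw [lineMap_lineMap_right]
  by_contra hcon
  have hη1 := hη.1
  have hη2 := hη.2
  have h1 : (1 - η / 2) * s < s := by nlinarith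
  have h2 := hleast ⟨⟨mul_nonneg (by linarith) hs0.le, h1.le.trans hs.2⟩, hcon⟩
  exact absurd h2 (not_le.2 h1)

end Contractions

/-! ### Quasitoric manifolds: fixed points and the cover -/

section Quasitoric

variable {n : ℕ} {M : Type*} [TopologicalSpace M]
  [ChartedSpace (EuclideanSpace ℝ (Fin (2 * n))) M] [MulAction (CompactTorus n) M]
  {P : Set (EuclideanSpace ℝ (Fin n))} {q : M → EuclideanSpace ℝ (Fin n)}

namespace IsQuasitoricOver

theorem continuousSMul (h : IsQuasitoricOver n M P q) : ContinuousSMul (CompactTorus n) M :=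
  ⟨h.smooth_action.continuous⟩

theorem convex (h : IsQuasitoricOver n M P q) : Convex ℝ P := by
  obtain ⟨S, -, rfl⟩ := h.simple_polytope.exists_finite
  exact convex_convexHull ℝ S

theorem isCompact (h : IsQuasitoricOver n M P q) : IsCompact P := by
  obtain ⟨S, hS, rfl⟩ := h.simple_polytope.exists_finite
  exact hS.isCompact_convexHull ℝ

theorem finite_extremePoints (h : IsQuasitoricOver n M P q) : (P.extremePoints ℝ).Finite := by
  obtain ⟨S, hS, rfl⟩ := h.simple_polytope.exists_finite
  exact hS.subset extremePoints_convexHull_subset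

/-- The fixed points are the points over the vertices. -/
theorem mem_fixedPoints_iff (h : IsQuasitoricOver n M P q) {x : M} :
    x ∈ MulAction.fixedPoints (CompactTorus n) M ↔ q x ∈ P.extremePoints ℝ := by
  obtain ⟨F, ⟨-, hF, hdim⟩, hx⟩ := h.orbit_dim x
  rw [← orbitDim_eq_zero_iff, ← hdim]
  constructor
  · intro h0
    rw [Submodule.finrank_eq_zero, vectorSpan_eq_bot_iff_subsingleton] at h0
    rw [← isExtreme_singleton, ← h0.eq_singleton_of_mem (intrinsicInterior_subset hx)]
    exact hF.isExtreme
  · intro hv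
    rw [eq_singleton_of_mem_extremePoints_of_mem_intrinsicInterior hv hF.subset hx,
      vectorSpan_singleton, finrank_bot]

theorem finite_fixedPoints (h : IsQuasitoricOver n M P q) :
    (MulAction.fixedPoints (CompactTorus n) M).Finite := by
  refine Finite.of_finite_image (f := q) (h.finite_extremePoints.subset ?_) ?_
  · rintro _ ⟨x, hx, rfl⟩
    exact h.mem_fixedPoints_iff.1 hx
  · intro x hx y hy hxy
    obtain ⟨t, rfl⟩ := (h.fibre_proj x y).1 hxy
    exact hy t

/-- In the open star of the vertex `v`, the stabilizers of a local section do not shrink when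
moving towards `v`. -/
theorem smul_section_lineMap (h : IsQuasitoricOver n M P q)
    {ψ : OpenPartialHomeomorph M (Fin n → ℂ)} {δ : CompactTorus n ≃ₜ* CompactTorus n}
    (hψ : IsEquivariantChart ψ δ) {O : Set (EuclideanSpace ℝ (Fin n))}
    {σ : EuclideanSpace ℝ (Fin n) → M} (hσ : ContinuousOn σ (O ∩ P))
    (hσO : ∀ p ∈ O ∩ P, σ p ∈ ψ.source ∧ q (σ p) = p) {v p : EuclideanSpace ℝ (Fin n)}
    (hv : v ∈ P.extremePoints ℝ) (hp : p ∈ vertexStar P v) {c : ℝ} (hc : c ∈ Icc (0 : ℝ) 1)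
    (hseg : ∀ c' ∈ Icc c 1, lineMap v p c' ∈ O) {t : CompactTorus n} (ht : t • σ p = σ p) :
    t • σ (lineMap v p c) = σ (lineMap v p c) := by
  have hOP (c' : ℝ) (hc' : c' ∈ Icc c 1) : lineMap v p c' ∈ O ∩ P :=
    ⟨hseg c' hc', h.convex.lineMap_mem hv.1 hp.1 ⟨hc.1.trans hc'.1, hc'.2⟩⟩
  have hcc : c ∈ Icc c 1 := ⟨le_rfl, hc.2⟩
  rcases hc.1.eq_or_lt with rfl | hc0
  · have h1 := (hσO _ (hOP 0 hcc)).2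
    rw [lineMap_apply_zero] at h1 ⊢
    exact h.mem_fixedPoints_iff.2 (h1.symm ▸ hv) t
  have hdim (c' : ℝ) (hc' : c' ∈ Icc c 1) :
      orbitDim (n := n) (σ (lineMap v p c')) = orbitDim (n := n) (σ p) := by
    obtain ⟨F, ⟨-, hF, hFdim⟩, hpF⟩ := h.orbit_dim (σ p)
    obtain ⟨F', ⟨-, hF', hFdim'⟩, hpF'⟩ := h.orbit_dim (σ (lineMap v p c'))
    have h1 := (hσO _ (hOP 1 ⟨hc.2, le_rfl⟩)).2
    rw [lineMap_apply_one] at h1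
    rw [h1] at hpF
    rw [(hσO _ (hOP c' hc')).2] at hpF'
    rw [← hFdim, ← hFdim', face_eq_of_lineMap h.convex hv.1 hp hF hF'
      ⟨hc0.trans_le hc'.1, hc'.2⟩ hpF hpF']
  let supp : ℝ → Set (Fin n) := fun c' => {i | ψ (σ (lineMap v p c')) i ≠ 0}
  have hcont : ContinuousOn (fun c' : ℝ => ψ (σ (lineMap v p c'))) (Icc c 1) :=
    (ψ.continuousOn.comp hσ fun y hy => (hσO y hy).1).comp lineMap_continuous.continuousOn hOP
  -- Nonvanishing is an open condition, so the support can only grow nearby; constancy of the orbit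
  -- dimension forbids growth. Hence it is locally constant on an interval.
  have hsupp : supp c = supp 1 := by
    let : TopologicalSpace (Set (Fin n)) := ⊥
    have : DiscreteTopology (Set (Fin n)) := ⟨rfl⟩
    refine isPreconnected_Icc.constant (s := Icc c 1) (f := supp) (fun c₁ hc₁ => ?_) hcc
      ⟨hc.2, le_rfl⟩
    have hev : ∀ᶠ c' in 𝓝[Icc c 1] c₁, ∀ i, ψ (σ (lineMap v p c₁)) i ≠ 0 →
        ψ (σ (lineMap v p c')) i ≠ 0 := by
      rw [eventually_all]
      intro i
      by_cases hi : ψ (σ (lineMap v p c₁)) i = 0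
      · simp [hi]
      · filter_upwards [((continuous_apply i).continuousAt.comp_continuousWithinAt
          (hcont c₁ hc₁)).eventually_ne hi] with c' hc' _ using hc'
    refine ContinuousWithinAt.congr_of_eventuallyEq (f := fun _ => supp c₁)
      continuousWithinAt_const ?_ rfl
    filter_upwards [hev, self_mem_nhdsWithin] with c' hc' hmem
    exact Subset.antisymm (fun i hi => hψ.ne_zero_of_orbitDim_eq (hσO _ (hOP c₁ hc₁)).1
      (hσO _ (hOP c' hmem)).1 hc' ((hdim c₁ hc₁).trans (hdim c' hmem).symm) hi) hc'
  have h1 := (hσO _ (hOP 1 ⟨hc.2, le_rfl⟩)).1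
  rw [hψ.smul_eq_self_iff (hσO _ (hOP c hcc)).1]
  intro i hi
  have hi' : i ∈ supp 1 := hsupp ▸ hi
  simp only [supp, lineMap_apply_one, mem_ofPred_eq] at hi' h1
  exact (hψ.smul_eq_self_iff h1).1 ht i hi'

theorem exists_isStarSection (h : IsQuasitoricOver n M P q) {v z : EuclideanSpace ℝ (Fin n)}
    (hv : v ∈ P.extremePoints ℝ) (hz : z ∈ vertexStar P v) :
    ∃ O σ, z ∈ O ∧ IsStarSection (CompactTorus n) P q v O σ := by
  have := h.compact
  obtain ⟨S, hS, hPS⟩ := h.simple_polytope.exists_finite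
  obtain ⟨x, rfl⟩ : z ∈ range q := h.range_proj ▸ hz.1
  obtain ⟨ψ, δ, hx, -, -, hψ⟩ := h.locally_standard x
  obtain ⟨O, σ, hO, hxO, hσ, hσO⟩ := IsEquivariantChart.exists_section h.continuous_proj
    h.fibre_proj (show IsEquivariantChart ψ δ from hψ) hx
  rw [h.range_proj] at hσ hσO
  obtain ⟨O', hO', hxO', hO'P⟩ := mem_nhdsWithin.1 (vertexStar_mem_nhdsWithin hS hPS hz)
  refine ⟨O ∩ O', σ, ⟨hxO, hxO'⟩, hO.inter hO', ?_, ?_, ?_, ?_⟩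
  · exact fun y hy => hO'P ⟨hy.1.2, hy.2⟩
  · exact hσ.mono fun y hy => ⟨hy.1.1, hy.2⟩
  · exact fun y hy => (hσO y ⟨hy.1.1, hy.2⟩).2
  · exact fun p hp c hc hseg t ht => h.smul_section_lineMap hψ hσ hσO hv
      (hO'P ⟨hp.1.2, hp.2⟩) hc (fun c' hc' => (hseg c' hc').1) ht

/-- Compactness gives finitely many contractible neighbourhoods, and those belonging to the same
vertex are merged. -/
theorem exists_cover (h : IsQuasitoricOver n M P q) :
    ∃ W : EuclideanSpace ℝ (Fin n) → Set (EuclideanSpace ℝ (Fin n)),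
      (∀ v, IsOpen (W v) ∧ IsRadiallyContractible (CompactTorus n) q v (W v)) ∧
      P ⊆ ⋃ v ∈ P.extremePoints ℝ, W v := by
  classical
  have := h.hausdorff
  have := h.continuousSMul
  refine h.isCompact.induction_on (p := fun s => ∃ W : EuclideanSpace ℝ (Fin n) → Set _,
    (∀ v, IsOpen (W v) ∧ IsRadiallyContractible (CompactTorus n) q v (W v)) ∧
      s ⊆ ⋃ v ∈ P.extremePoints ℝ, W v) ?_ ?_ ?_ ?_
  · exact ⟨fun _ => ∅, fun v => ⟨isOpen_empty, isRadiallyContractible_empty⟩, empty_subset _⟩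
  · exact fun s t hst ⟨W, hW, ht⟩ => ⟨W, hW, hst.trans ht⟩
  · rintro s t ⟨W, hW, hs⟩ ⟨W', hW', ht⟩
    refine ⟨fun v => W v ∪ W' v, fun v => ⟨(hW v).1.union (hW' v).1, (hW v).2.union (hW' v).2⟩, ?_⟩
    exact union_subset (hs.trans (iUnion₂_mono fun v _ => subset_union_left))
      (ht.trans (iUnion₂_mono fun v _ => subset_union_right))
  · intro p hp
    obtain ⟨x, rfl⟩ : p ∈ range q := h.range_proj ▸ hp
    obtain ⟨F, ⟨-, hF, -⟩, hxF⟩ := h.orbit_dim x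
    obtain ⟨v, hv, hxv⟩ := exists_mem_vertexStar h.isCompact hF hxF
    obtain ⟨N, hN, hNc⟩ := exists_isRadiallyContractible_nhds (G := CompactTorus n) h.convex hv.1
      h.continuous_proj h.range_proj h.fibre_proj (fun z hz => h.exists_isStarSection hv hz) hxv
    refine ⟨interior N, mem_nhdsWithin_of_mem_nhds (interior_mem_nhds.2 hN),
      fun v' => if v' = v then interior N else ∅, fun v' => ?_, ?_⟩
    · by_cases hv' : v' = v
      · subst hv'
        simpa using hNc.mono interior_subset
      · simpa [hv'] using isRadiallyContractible_empty
    · exact subset_iUnion₂_of_subset v hv (by simp)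

theorem isGCategorical_preimage (h : IsQuasitoricOver n M P q)
    {W : Set (EuclideanSpace ℝ (Fin n))} {x₀ : M} (hW : IsOpen W)
    (hWc : IsRadiallyContractible (CompactTorus n) q (q x₀) W) :
    IsGCategorical (CompactTorus n) (q ⁻¹' W) := by
  obtain ⟨H, hH, hHW⟩ := hWc
  have hinv (t : CompactTorus n) (x : M) : q (t • x) = q x := (h.fibre_proj _ _).2 ⟨t, rfl⟩
  refine ⟨hW.preimage h.continuous_proj, fun t x hx => by rwa [mem_preimage, hinv],
    ⟨fun y => H (y.1, y.2), by fun_prop⟩, fun t x s => (hH.smul t x s).symm, fun x => hH.zero x,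
    x₀, fun x => (h.fibre_proj _ _).1 ?_⟩
  exact hHW x (q x) x.2 1 (by simp) (by simp)

theorem hasGCategoricalCover (h : IsQuasitoricOver n M P q) {k : ℕ}
    (hk : (MulAction.fixedPoints (CompactTorus n) M).encard = k) :
    HasGCategoricalCover (CompactTorus n) M k := by
  obtain ⟨W, hW, hPW⟩ := h.exists_cover
  have := h.finite_fixedPoints.to_subtype
  have hcard : Nat.card (MulAction.fixedPoints (CompactTorus n) M) = k := by
    rw [Nat.card_coe_set_eq, ncard_def, hk, ENat.toNat_natCast]
  let e := Finite.equivFinOfCardEq hcard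
  refine ⟨fun i => q ⁻¹' W (q (e.symm i)),
    fun i => h.isGCategorical_preimage (hW _).1 (hW _).2, eq_univ_of_forall fun x => ?_⟩
  obtain ⟨v, hv, hxv⟩ := mem_iUnion₂.1 (hPW (h.range_proj ▸ mem_range_self x))
  obtain ⟨y, rfl⟩ : v ∈ range q := h.range_proj ▸ hv.1
  refine mem_iUnion.2 ⟨e ⟨y, h.mem_fixedPoints_iff.2 hv⟩, ?_⟩
  simpa using hxv

end IsQuasitoricOver

end Quasitoric

/-! ### The lower bound and the theorem -/

/-- If the fixed points are finite in number, a `G`-categorical set contains at most one of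
them. -/
theorem IsGCategorical.eq_of_mem_fixedPoints {G X : Type*} [Group G] [TopologicalSpace X]
    [T1Space X] [MulAction G X] (hfin : (MulAction.fixedPoints G X).Finite) {U : Set X}
    (hU : IsGCategorical G U) {x y : X} (hx : x ∈ MulAction.fixedPoints G X)
    (hy : y ∈ MulAction.fixedPoints G X) (hxU : x ∈ U) (hyU : y ∈ U) : x = y := by
  obtain ⟨-, hinv, H, hH, h0, z, hz⟩ := hU
  have key (x : X) (hx : x ∈ MulAction.fixedPoints G X) (hxU : x ∈ U) :
      x ∈ MulAction.orbit G z := by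
    have hfix (t : unitInterval) : H (⟨x, hxU⟩, t) ∈ MulAction.fixedPoints G X := fun g => by
      rw [hH]
      congr 3
      exact hx g
    have h01 : H (⟨x, hxU⟩, 0) = H (⟨x, hxU⟩, 1) :=
      isPreconnected_univ.constant_of_mapsTo (S := (univ : Set unitInterval)) hfin.isDiscrete
        (f := fun t => H (⟨x, hxU⟩, t)) (by fun_prop) (fun t _ => hfix t) trivial trivial
    rw [h0] at h01
    rw [show x = _ from h01]
    exact hz _
  obtain ⟨g, hg⟩ := key x hx hxU
  obtain ⟨g', hg'⟩ := key y hy hyU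
  -- An orbit that contains a fixed point is that point alone.
  have h1 : z = x := by rw [← hx g⁻¹]; exact (inv_smul_eq_iff.2 hg.symm).symm
  have h2 : z = y := by rw [← hy g'⁻¹]; exact (inv_smul_eq_iff.2 hg'.symm).symm
  rw [← h1, h2]

theorem HasGCategoricalCover.card_fixedPoints_le {G X : Type*} [Group G] [TopologicalSpace X]
    [T1Space X] [MulAction G X] (hfin : (MulAction.fixedPoints G X).Finite) {m : ℕ}
    (h : HasGCategoricalCover G X m) : (MulAction.fixedPoints G X).ncard ≤ m := by
  obtain ⟨U, hU, hcov⟩ := h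
  have hex (x : X) : ∃ i, x ∈ U i := mem_iUnion.1 (hcov ▸ mem_univ x)
  choose i hi using hex
  rw [← Nat.card_coe_set_eq, ← Nat.card_fin m]
  refine Nat.card_le_card_of_injective (fun x : MulAction.fixedPoints G X => i x) ?_
  intro x y hxy
  have hxy : i x = i y := hxy
  exact Subtype.ext ((hU (i x)).eq_of_mem_fixedPoints hfin x.2 y.2 (hi x) (hxy ▸ hi y))

theorem mainTheorem1 (n : ℕ) (M : Type*) [TopologicalSpace M]
    [ChartedSpace (EuclideanSpace ℝ (Fin (2 * n))) M] [MulAction (CompactTorus n) M]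
    (hM : IsQuasitoricManifold n M) :
    (MulAction.fixedPoints (CompactTorus n) M).Finite ∧
    ∀ k : ℕ, (MulAction.fixedPoints (CompactTorus n) M).encard = k →
      equivariantLSCat (CompactTorus n) M = k := by
  obtain ⟨P, q, h⟩ := hM
  have := h.hausdorff
  refine ⟨h.finite_fixedPoints, fun k hk => le_antisymm ?_ ?_⟩
  · exact iInf₂_le k (h.hasGCategoricalCover hk)
  · refine le_iInf₂ fun m hm => ?_
    rw [← hk, ← h.finite_fixedPoints.cast_ncard_eq]
    exact_mod_cast hm.card_fixedPoints_le h.finite_fixedPoints
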